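/- All graphs are finite, undirected, without loops. A full homomorphism $f:G\to H$ is a map $V_G\to V_H$ such that $uv\in E_G \iff f(u)f(v)\in E_H$ for all $u,v\in V_G$. Let $C_k$ be the cycle on $k$ vertices, let $P_4$ be the path with $4$ edges (on the $5$ vertices $v_0,\dots,v_4$), and let $A$ be the graph with vertices $v_0,\dots,v_5$ and edges $v_0v_1, v_1v_2, v_1v_4, v_2v_3, v_3v_4, v_4v_5$. In a graph whose edges are colored with colors from a finite set, an exact Gallai clique is a complete subgraph induced by a nonempty set of vertices (with the restricted coloring) in which the edges of every triangle have exactly two colors. A monochrome of such a clique $K$ is a connected component of the graph $K(\alpha)$ for some color $\alpha$, where $K(\alpha)$ has all vertices of $K$ and exactly the edges of $K$ of color $\alpha$; it is considered as an uncolored graph. Theorem. Let $G$ be a connected (in particular nonempty) graph. There is no full homomorphism into $G$ from any of the graphs $C_3$, $P_4$, $A$ if and only if there is a full homomorphism from $G$ into $C_5$. Moreover, the connected graphs $G$ satisfying this condition are, up to isomorphism, precisely the monochromes of exact Gallai cliques: a connected graph $G$ admits a full homomorphism into $C_5$ if and only if it is isomorphic to a monochrome of some exact Gallai clique. -/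

import Mathlib

universe u w x

/-- A map between the vertex sets of two graphs is a full homomorphism if it preserves and
reflects adjacency (it need not be injective). -/
def IsFullHom {V : Type*} {V' : Type*} (G : SimpleGraph V) (H : SimpleGraph V') (f : V → V') :
    Prop :=
  ∀ v₁ v₂ : V, G.Adj v₁ v₂ ↔ H.Adj (f v₁) (f v₂)

/-- There is a full homomorphism from `G` into `H`. -/
def FullHomTo {V : Type*} {V' : Type*} (G : SimpleGraph V) (H : SimpleGraph V') : Prop :=
  ∃ f : V → V', IsFullHom G H f

/-- The `k`-path: vertices `v₀, …, v_k` (so `k + 1` of them) and edges `vᵢvᵢ₊₁`. -/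
abbrev pathP (k : ℕ) : SimpleGraph (Fin (k + 1)) := SimpleGraph.pathGraph (k + 1)

/-- The graph `A`: vertices `v₀, …, v₅` and edges `v₀v₁, v₁v₂, v₁v₄, v₂v₃, v₃v₄, v₄v₅`. -/
def graphA : SimpleGraph (Fin 6) :=
  SimpleGraph.fromEdgeSet {s(0, 1), s(1, 2), s(1, 4), s(2, 3), s(3, 4), s(4, 5)}

section ColoredGraphs

/- A colored graph is a graph `H` together with an assignment `C : H.EdgeLabeling Γ` of a color
to each edge. A clique is given by its set `s` of vertices, colored by restriction. -/

variable {W : Type*} {Γ : Type*} {H : SimpleGraph W}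

/-- The set of the colors of the edges of the triangle `v₁v₂v₃`. -/
def triangleColors (C : H.EdgeLabeling Γ) {v₁ v₂ v₃ : W}
    (h₁₂ : H.Adj v₁ v₂) (h₂₃ : H.Adj v₂ v₃) (h₃₁ : H.Adj v₃ v₁) : Set Γ :=
  {C.get v₁ v₂ h₁₂, C.get v₂ v₃ h₂₃, C.get v₃ v₁ h₃₁}

/-- A triangle is colorful if its three edges have pairwise different colors. -/
def IsColorfulTriangle (C : H.EdgeLabeling Γ) {v₁ v₂ v₃ : W}
    (h₁₂ : H.Adj v₁ v₂) (h₂₃ : H.Adj v₂ v₃) (h₃₁ : H.Adj v₃ v₁) : Prop :=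
  C.get v₁ v₂ h₁₂ ≠ C.get v₂ v₃ h₂₃ ∧ C.get v₂ v₃ h₂₃ ≠ C.get v₃ v₁ h₃₁ ∧
    C.get v₃ v₁ h₃₁ ≠ C.get v₁ v₂ h₁₂

/-- A Gallai clique: a nonempty clique without colorful triangles. -/
structure IsGallaiClique (C : H.EdgeLabeling Γ) (s : Set W) : Prop where
  nonempty : s.Nonempty
  isClique : H.IsClique s
  not_colorful : ∀ v₁ ∈ s, ∀ v₂ ∈ s, ∀ v₃ ∈ s,
    ∀ (h₁₂ : H.Adj v₁ v₂) (h₂₃ : H.Adj v₂ v₃) (h₃₁ : H.Adj v₃ v₁),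
      ¬ IsColorfulTriangle C h₁₂ h₂₃ h₃₁

/-- An exact Gallai clique: a Gallai clique in which every triangle has edges of exactly two
colors. -/
structure IsExactGallaiClique (C : H.EdgeLabeling Γ) (s : Set W) : Prop
    extends IsGallaiClique C s where
  exact_two : ∀ v₁ ∈ s, ∀ v₂ ∈ s, ∀ v₃ ∈ s,
    ∀ (h₁₂ : H.Adj v₁ v₂) (h₂₃ : H.Adj v₂ v₃) (h₃₁ : H.Adj v₃ v₁),
      (triangleColors C h₁₂ h₂₃ h₃₁).ncard = 2

/-- `G` is (isomorphic to) a monochrome of the clique on `s`: for some color `α`, it is a connected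
component of the graph on `s` formed by the edges of color `α`. -/
def IsMonochromeOf {V : Type*} (G : SimpleGraph V) (C : H.EdgeLabeling Γ) (s : Set W) : Prop :=
  ∃ (α : Γ) (K : ((C.labelGraph α).induce s).ConnectedComponent), Nonempty (G ≃g K.toSimpleGraph)

end ColoredGraphs

/-- `G` is (isomorphic to) a monochrome of some exact Gallai clique in a finite graph colored with
finitely many colors. -/
def IsExactGallaiMonochrome {V : Type u} (G : SimpleGraph V) : Prop :=
  ∃ (W : Type w) (Γ : Type x) (_ : Finite W) (_ : Finite Γ) (H : SimpleGraph W)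
    (C : H.EdgeLabeling Γ) (s : Set W), IsExactGallaiClique C s ∧ IsMonochromeOf G C s

namespace FullHom

variable {V : Type*} {G : SimpleGraph V}

/-! The three conditions are linked in a cycle: forbidden graphs excluded, then a full homomorphism
into the 5-cycle, then a monochrome, then exclusion again. For the first implication, fix the
largest available core in `G` among the 5-cycle, the path with 3 edges, and an edge. Excluding the
forbidden graphs forces every vertex to see the core as some core vertex does, and adjacency in `G`
depends only on these types. So `G` is a blow-up of the core, and each core embeds fully in the
5-cycle. For the second, the 5-cycle and its complement are both triangle-free, so they 2-color the
pairs of distinct fibers; inside the fibers, a vertex order supplies further colors. For the third,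
a forbidden graph would sit inside the clique, and the absence of colorful triangles would propagate
equal colors until some triangle is monochromatic. -/

theorem fullHomTo_trans {V₁ V₂ V₃ : Type*} {G₁ : SimpleGraph V₁} {G₂ : SimpleGraph V₂}
    {G₃ : SimpleGraph V₃} (h : FullHomTo G₁ G₂) (h' : FullHomTo G₂ G₃) : FullHomTo G₁ G₃ := by
  obtain ⟨f, hf⟩ := h
  obtain ⟨g, hg⟩ := h'
  exact ⟨g ∘ f, fun a b => (hf a b).trans (hg _ _)⟩

/-! ### Forbidden induced subgraphs -/

/-- `G` has no triangle. -/
def TriangleFree (G : SimpleGraph V) : Prop :=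
  ∀ a b c, G.Adj a b → G.Adj b c → G.Adj a c → False

/-- `G` has no induced path with four edges. -/
def PathFree (G : SimpleGraph V) : Prop :=
  ∀ a b c d e, G.Adj a b → G.Adj b c → G.Adj c d → G.Adj d e →
    ¬ G.Adj a c → ¬ G.Adj a d → ¬ G.Adj a e → ¬ G.Adj b d → ¬ G.Adj b e → ¬ G.Adj c e → False

/-- `G` has no induced copy of `graphA`, given as the 4-cycle `b c d e` with
pendant vertices `a` at `b` and `f` at `e`. -/
def GraphAFree (G : SimpleGraph V) : Prop :=
  ∀ a b c d e f, G.Adj a b → G.Adj b c → G.Adj b e → G.Adj c d → G.Adj d e → G.Adj e f →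
    ¬ G.Adj a c → ¬ G.Adj a d → ¬ G.Adj a e → ¬ G.Adj a f → ¬ G.Adj b d → ¬ G.Adj b f →
    ¬ G.Adj c e → ¬ G.Adj c f → ¬ G.Adj d f → False

theorem triangleFree_of_not_fullHomTo (h : ¬ FullHomTo (SimpleGraph.cycleGraph 3) G) :
    TriangleFree G := by
  intro a b c h1 h2 h3
  refine h ⟨![a, b, c], fun i j => ?_⟩
  have : (SimpleGraph.cycleGraph 3).Adj i j ↔ i ≠ j := by revert i j; decide
  rw [this]
  fin_cases i <;> fin_cases j <;> simp [h1, h2, h3, h1.symm, h2.symm, h3.symm]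

theorem pathFree_of_not_fullHomTo (h : ¬ FullHomTo (pathP 4) G) : PathFree G := by
  intro a b c d e h1 h2 h3 h4 n1 n2 n3 n4 n5 n6
  refine h ⟨![a, b, c, d, e], fun i j => ?_⟩
  rw [SimpleGraph.pathGraph_adj]
  fin_cases i <;> fin_cases j <;>
    simp [h1, h2, h3, h4, n1, n2, n3, n4, n5, n6, h1.symm, h2.symm, h3.symm, h4.symm,
      G.adj_comm c a, G.adj_comm d a, G.adj_comm e a, G.adj_comm d b, G.adj_comm e b,
      G.adj_comm e c]

theorem graphAFree_of_not_fullHomTo (h : ¬ FullHomTo graphA G) : GraphAFree G := by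
  intro a b c d e f h1 h2 h3 h4 h5 h6 n1 n2 n3 n4 n5 n6 n7 n8 n9
  refine h ⟨![a, b, c, d, e, f], fun i j => ?_⟩
  rw [graphA, SimpleGraph.fromEdgeSet_adj]
  fin_cases i <;> fin_cases j <;>
    simp [h1, h2, h3, h4, h5, h6, n1, n2, n3, n4, n5, n6, n7, n8, n9, h1.symm, h2.symm, h3.symm,
      h4.symm, h5.symm, h6.symm, G.adj_comm c a, G.adj_comm d a, G.adj_comm e a, G.adj_comm f a,
      G.adj_comm d b, G.adj_comm f b, G.adj_comm e c, G.adj_comm f c, G.adj_comm f d]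

/-! ### Blow-ups of a core -/

/-- `v` sees the image of `c` as the vertex `i` of `H` sees `H`. -/
def HasType {I : Type*} (H : SimpleGraph I) (G : SimpleGraph V) (c : I → V) (v : V) (i : I) :
    Prop :=
  ∀ k, G.Adj v (c k) ↔ H.Adj i k

/-- Core vertices have their own type, and `hstep` carries typedness along walks to all of the
connected graph; sending each vertex to a type is then full by `hadj`. -/
theorem fullHomTo_of_hasType {I : Type*} {H : SimpleGraph I} [Nonempty I] (hG : G.Connected)
    (c : I → V) (hc : IsFullHom H G c)
    (hstep : ∀ u w i, HasType H G c u i → G.Adj u w → ∃ j, HasType H G c w j)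
    (hadj : ∀ u v i j, HasType H G c u i → HasType H G c v j → (G.Adj u v ↔ H.Adj i j)) :
    FullHomTo G H := by
  have key : ∀ v, ∃ i, HasType H G c v i := by
    intro v
    obtain ⟨i₀⟩ := ‹Nonempty I›
    obtain ⟨p⟩ := hG.preconnected v (c i₀)
    have : ∀ {x y : V} (_ : G.Walk x y), (∃ i, HasType H G c y i) → ∃ i, HasType H G c x i := by
      intro x y p
      induction p with
      | nil => exact id
      | cons h p ih =>
        intro hy
        obtain ⟨i, hi⟩ := ih hy
        exact hstep _ _ i hi h.symm
    exact this p ⟨i₀, fun k => (hc _ _).symm⟩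
  choose t ht using key
  exact ⟨t, fun u v => hadj u v _ _ (ht u) (ht v)⟩

/-- A typed vertex can replace its core vertex, so facts about neighbors of the core also apply to
neighbors of `u`. -/
theorem isFullHom_update {I : Type*} [DecidableEq I] {H : SimpleGraph I} {c : I → V}
    (hc : IsFullHom H G c) {u : V} {i : I} (hu : HasType H G c u i) :
    IsFullHom H G (Function.update c i u) := by
  intro a b
  by_cases ha : a = i <;> by_cases hb : b = i
  · subst ha; subst hb; simp
  · subst ha; simp [hb, hu b]
  · subst hb; simp [ha, G.adj_comm _ u, H.adj_comm _ b, hu a]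
  · simp [ha, hb, hc a b]

theorem exists_hasType_cycle (h3 : TriangleFree G) (hP : PathFree G) {c : Fin 5 → V}
    (hc : IsFullHom (SimpleGraph.cycleGraph 5) G c) {v : V} (hv : ∃ k, G.Adj v (c k)) :
    ∃ i, HasType (SimpleGraph.cycleGraph 5) G c v i := by
  classical
  -- A nonempty neighborhood on the cycle is two vertices at distance 2: consecutive ones give a
  -- triangle, and a lone one starts an induced 4-edge path.
  have key : ∀ b : Fin 5 → Bool, (∀ m, ¬ (b m ∧ b (m + 1))) → (∀ m, b m → b (m + 2) ∨ b (m + 3)) →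
      (∃ k, b k) → ∃ i, ∀ k, b k ↔ (SimpleGraph.cycleGraph 5).Adj i k := by decide
  have e1 : ∀ m, G.Adj (c m) (c (m + 1)) := fun m => (hc _ _).1 (by revert m; decide)
  have e2 : ∀ m, ¬ G.Adj (c m) (c (m + 2)) := fun m => (hc _ _).not.1 (by revert m; decide)
  have e3 : ∀ m, ¬ G.Adj (c m) (c (m + 3)) := fun m => (hc _ _).not.1 (by revert m; decide)
  have tri : ∀ m, ¬ (G.Adj v (c m) ∧ G.Adj v (c (m + 1))) :=
    fun m h => h3 _ _ _ h.1 (e1 m) h.2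
  have := key (fun k => decide (G.Adj v (c k))) (by simpa using tri) (fun m hm => by
    simp only [decide_eq_true_eq] at hm ⊢
    by_contra! hcon
    have r1 : m + 1 + 1 = m + 2 := add_assoc m 1 1
    have r2 : m + 2 + 1 = m + 3 := add_assoc m 2 1
    have r3 : m + 1 + 2 = m + 3 := add_assoc m 1 2
    exact hP v (c m) (c (m + 1)) (c (m + 2)) (c (m + 3)) hm (e1 m) (r1 ▸ e1 (m + 1))
      (r2 ▸ e1 (m + 2)) (fun h => tri m ⟨hm, h⟩) hcon.1 hcon.2 (e2 m) (e3 m)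
      (r3 ▸ e2 (m + 1))) (by simpa using hv)
  simpa [HasType] using this

theorem fullHomTo_cycle_of_cycle (hG : G.Connected) (h3 : TriangleFree G) (hP : PathFree G)
    (h : FullHomTo (SimpleGraph.cycleGraph 5) G) : FullHomTo G (SimpleGraph.cycleGraph 5) := by
  obtain ⟨c, hc⟩ := h
  refine fullHomTo_of_hasType hG c hc ?_ ?_
  · intro u w i hu huw
    obtain ⟨j, hj⟩ := exists_hasType_cycle h3 hP (isFullHom_update hc hu) (v := w)
      ⟨i, by simpa using huw.symm⟩
    -- One of the two neighbors of `j` survives the replacement at `i`, so `w` sees the original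
    -- cycle.
    have : ∀ i j : Fin 5, ∃ k, k ≠ i ∧ (SimpleGraph.cycleGraph 5).Adj j k := by decide
    obtain ⟨k, hk, hjk⟩ := this i j
    refine exists_hasType_cycle h3 hP hc ⟨k, ?_⟩
    have := (hj k).2 hjk
    rwa [Function.update_of_ne hk] at this
  · intro u v i j hu hv
    have h1 : ∀ i j : Fin 5, ∃ k, k ≠ i ∧ (SimpleGraph.cycleGraph 5).Adj j k := by decide
    have h2 : ∀ i j j' : Fin 5, (∀ k, k ≠ i → ((SimpleGraph.cycleGraph 5).Adj j k ↔
      (SimpleGraph.cycleGraph 5).Adj j' k)) → j = j' := by decide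
    obtain ⟨k, hk, hjk⟩ := h1 i j
    -- The type of `v` on the cycle through `u` agrees with `j` away from `i`, hence equals `j`; its
    -- entry at `i` decides whether `u` and `v` are adjacent.
    obtain ⟨j', hj'⟩ := exists_hasType_cycle h3 hP (isFullHom_update hc hu) (v := v)
      ⟨k, by rw [Function.update_of_ne hk]; exact (hv k).2 hjk⟩
    have hjj : j = j' := h2 i j j' fun k hk => by
      have := hj' k
      rw [Function.update_of_ne hk] at this
      exact (hv k).symm.trans this
    have := hj' i
    rw [Function.update_self] at this
    rw [G.adj_comm, this, hjj, SimpleGraph.adj_comm]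

theorem fullHomTo_path_of_path (hG : G.Connected) (h3 : TriangleFree G) (hP : PathFree G)
    (hA : GraphAFree G) (h5 : ¬ FullHomTo (SimpleGraph.cycleGraph 5) G)
    (h : FullHomTo (pathP 3) G) : FullHomTo G (pathP 3) := by
  obtain ⟨c, hc⟩ := h
  have a01 : G.Adj (c 0) (c 1) := (hc _ _).1 (by simp [SimpleGraph.pathGraph_adj])
  have a12 : G.Adj (c 1) (c 2) := (hc _ _).1 (by simp [SimpleGraph.pathGraph_adj])
  have a23 : G.Adj (c 2) (c 3) := (hc _ _).1 (by simp [SimpleGraph.pathGraph_adj])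
  have n02 : ¬ G.Adj (c 0) (c 2) := (hc _ _).not.1 (by simp [SimpleGraph.pathGraph_adj])
  have n03 : ¬ G.Adj (c 0) (c 3) := (hc _ _).not.1 (by simp [SimpleGraph.pathGraph_adj])
  have n13 : ¬ G.Adj (c 1) (c 3) := (hc _ _).not.1 (by simp [SimpleGraph.pathGraph_adj])
  -- Such a vertex would close the path to an induced 5-cycle.
  have no5 : ∀ v, ¬ (G.Adj v (c 0) ∧ G.Adj v (c 3) ∧ ¬ G.Adj v (c 1) ∧ ¬ G.Adj v (c 2)) := by
    rintro v ⟨h0, h3, h1, h2⟩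
    refine h5 ⟨![c 0, c 1, c 2, c 3, v], fun i j => ?_⟩
    have : (SimpleGraph.cycleGraph 5).Adj i j ↔ (j = i + 1 ∨ i = j + 1) := by revert i j; decide
    rw [this]
    fin_cases i <;> fin_cases j <;>
      simp [a01, a12, a23, n02, n03, n13, h0, h3, h1, h2, a01.symm, a12.symm, a23.symm, h0.symm,
        h3.symm, G.adj_comm (c 1) v, G.adj_comm (c 2) v, G.adj_comm (c 2) (c 0),
        G.adj_comm (c 3) (c 0), G.adj_comm (c 3) (c 1)]
  have typed : ∀ v i, HasType (pathP 3) G c v i ↔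
      (G.Adj v (c 0) ↔ i = 1) ∧ (G.Adj v (c 1) ↔ i = 0 ∨ i = 2) ∧
      (G.Adj v (c 2) ↔ i = 1 ∨ i = 3) ∧ (G.Adj v (c 3) ↔ i = 2) := by
    intro v i
    simp only [HasType, Fin.forall_fin_succ, Fin.forall_fin_zero, SimpleGraph.pathGraph_adj]
    fin_cases i <;> simp
  have ex : ∀ v, (∃ k, G.Adj v (c k)) → ∃ i, HasType (pathP 3) G c v i := by
    intro v hv
    have key : ∀ b₀ b₁ b₂ b₃ : Prop, ¬ (b₀ ∧ b₁) → ¬ (b₁ ∧ b₂) → ¬ (b₂ ∧ b₃) →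
        (b₀ → b₁ ∨ b₂ ∨ b₃) → (b₃ → b₂ ∨ b₁ ∨ b₀) → ¬ (b₀ ∧ b₃ ∧ ¬ b₁ ∧ ¬ b₂) →
        (b₀ ∨ b₁ ∨ b₂ ∨ b₃) → ∃ i : Fin 4, (b₀ ↔ i = 1) ∧ (b₁ ↔ i = 0 ∨ i = 2) ∧
        (b₂ ↔ i = 1 ∨ i = 3) ∧ (b₃ ↔ i = 2) := by
      intro b₀ b₁ b₂ b₃
      by_cases h₀ : b₀ <;> by_cases h₁ : b₁ <;> by_cases h₂ : b₂ <;> by_cases h₃ : b₃ <;>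
        simp [h₀, h₁, h₂, h₃, Fin.exists_fin_succ]
    simp only [typed]
    refine key _ _ _ _ (fun h => h3 _ _ _ h.1 a01 h.2) (fun h => h3 _ _ _ h.1 a12 h.2)
      (fun h => h3 _ _ _ h.1 a23 h.2) (fun h => ?_) (fun h => ?_) (no5 v)
      (by simpa [Fin.exists_fin_succ] using hv)
    · by_contra! hn
      exact hP v (c 0) (c 1) (c 2) (c 3) h a01 a12 a23 hn.1 hn.2.1 hn.2.2 n02 n03 n13
    · by_contra! hn
      exact hP v (c 3) (c 2) (c 1) (c 0) h a23.symm a12.symm a01.symm hn.1 hn.2.1 hn.2.2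
        (fun h => n13 h.symm) (fun h => n03 h.symm) (fun h => n02 h.symm)
  refine fullHomTo_of_hasType hG c hc ?_ ?_
  · intro u w i hu huw
    -- If `w` sees no core vertex, an end type for `u` yields an induced 4-edge path and an inner
    -- type yields `graphA`.
    by_contra hw
    have hw' : ∀ k, ¬ G.Adj w (c k) := fun k hk => hw (ex w ⟨k, hk⟩)
    have w0 := hw' 0
    have w1 := hw' 1
    have w2 := hw' 2
    have w3 := hw' 3
    obtain ⟨u0, u1, u2, u3⟩ := (typed _ _).1 hu
    fin_cases i <;> simp at u0 u1 u2 u3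
    · apply hP w u (c 1) (c 2) (c 3) <;>
          first | assumption | (rw [G.adj_comm]; assumption)
    · apply hA w u (c 0) (c 1) (c 2) (c 3) <;>
          first | assumption | (rw [G.adj_comm]; assumption)
    · apply hA w u (c 3) (c 2) (c 1) (c 0) <;>
          first | assumption | (rw [G.adj_comm]; assumption)
    · apply hP w u (c 2) (c 1) (c 0) <;>
          first | assumption | (rw [G.adj_comm]; assumption)
  -- Types of equal parity share a core neighbor, so adjacency gives a triangle. A wrong adjacency
  -- between types 1 and 2 gives the 4-edge path, and for the other pairs `graphA`.
  · have main : ∀ u v i j, i ≤ j → HasType (pathP 3) G c u i → HasType (pathP 3) G c v j →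
        (G.Adj u v ↔ (pathP 3).Adj i j) := by
      intro u v i j hij hu hv
      obtain ⟨u0, u1, u2, u3⟩ := (typed _ _).1 hu
      obtain ⟨v0, v1, v2, v3⟩ := (typed _ _).1 hv
      have T : ∀ k, G.Adj u (c k) → G.Adj v (c k) → ¬ G.Adj u v :=
        fun k hk hk' huv => h3 u v (c k) huv hk' hk
      rw [SimpleGraph.pathGraph_adj]
      fin_cases i <;> fin_cases j <;> simp at u0 u1 u2 u3 v0 v1 v2 v3 hij ⊢
      · exact T 1 u1 v1
      · by_contra h
        apply hA u (c 1) (c 0) v (c 2) (c 3) <;>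
          first | assumption | (rw [G.adj_comm]; assumption)
      · exact T 1 u1 v1
      · intro h
        apply hA (c 0) (c 1) u v (c 2) (c 3) <;>
          first | assumption | (rw [G.adj_comm]; assumption)
      · exact T 0 u0 v0
      · by_contra h
        apply hP (c 0) u (c 2) (c 3) v <;>
          first | assumption | (rw [G.adj_comm]; assumption)
      · exact T 2 u2 v2
      · exact T 1 u1 v1
      · by_contra h
        apply hA (c 0) (c 1) u (c 3) (c 2) v <;>
          first | assumption | (rw [G.adj_comm]; assumption)
      · exact T 2 u2 v2
    intro u v i j hu hv
    rcases le_total i j with h | h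
    · exact main u v i j h hu hv
    · rw [G.adj_comm, (pathP 3).adj_comm]
      exact main v u j i h hv hu

/-- Without triangles and induced 3-edge paths, `G` is complete bipartite, with the neighborhoods of
`x` and `y` as its parts. -/
theorem fullHomTo_top_of_adj (hG : G.Connected) (h3 : TriangleFree G)
    (h4 : ¬ FullHomTo (pathP 3) G) {x y : V} (hxy : G.Adj x y) :
    FullHomTo G (⊤ : SimpleGraph Bool) := by
  have no4 : ∀ a b c d, G.Adj a b → G.Adj b c → G.Adj c d → ¬ G.Adj a c → ¬ G.Adj a d →
      ¬ G.Adj b d → False := by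
    intro a b c d h1 h2 h3 n1 n2 n3
    refine h4 ⟨![a, b, c, d], fun i j => ?_⟩
    rw [SimpleGraph.pathGraph_adj]
    fin_cases i <;> fin_cases j <;>
      simp [h1, h2, h3, n1, n2, n3, h1.symm, h2.symm, h3.symm, G.adj_comm c a, G.adj_comm d a,
        G.adj_comm d b]
  have typed : ∀ v i, HasType ⊤ G (fun b : Bool => if b then x else y) v i ↔
      (G.Adj v x ↔ i = false) ∧ (G.Adj v y ↔ i = true) := by
    intro v i
    cases i <;> simp [HasType, and_comm]
  refine fullHomTo_of_hasType hG (fun b : Bool => if b then x else y) ?_ ?_ ?_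
  · intro a b
    cases a <;> cases b <;> simp [hxy, hxy.symm]
  · intro u w i hu huw
    simp only [typed] at hu ⊢
    by_cases hx : G.Adj w x
    · exact ⟨false, by simpa [hx] using fun h => h3 w x y hx hxy h⟩
    · by_cases hy : G.Adj w y
      · exact ⟨true, by simpa [hy] using hx⟩
      · exfalso
        cases i
        · apply no4 w u x y <;> simp_all [G.adj_comm]
        · apply no4 w u y x <;> simp_all [G.adj_comm]
  · intro u v i j hu hv
    simp only [typed] at hu hv
    cases i <;> cases j <;> simp at hu hv ⊢
    · exact fun h => h3 u v x h hv.1 hu.1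
    · by_contra h
      apply no4 u x y v <;> simp_all [G.adj_comm]
    · by_contra h
      apply no4 u y x v <;> simp_all [G.adj_comm]
    · exact fun h => h3 u v y h hv.2 hu.2

theorem fullHomTo_cycle_of_free (hG : G.Connected) (h3 : TriangleFree G) (hP : PathFree G)
    (hA : GraphAFree G) : FullHomTo G (SimpleGraph.cycleGraph 5) := by
  by_cases h5 : FullHomTo (SimpleGraph.cycleGraph 5) G
  · exact fullHomTo_cycle_of_cycle hG h3 hP h5
  by_cases h4 : FullHomTo (pathP 3) G
  · refine fullHomTo_trans (fullHomTo_path_of_path hG h3 hP hA h5 h4) ⟨![0, 1, 2, 3], ?_⟩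
    unfold IsFullHom
    simp only [SimpleGraph.pathGraph_adj]
    decide
  by_cases h2 : ∃ x y, G.Adj x y
  · obtain ⟨x, y, hxy⟩ := h2
    refine fullHomTo_trans (fullHomTo_top_of_adj hG h3 h4 hxy) ⟨fun b => if b then 0 else 1, ?_⟩
    unfold IsFullHom
    decide
  · push Not at h2
    exact ⟨fun _ => 0, fun a b => by simp [h2 a b]⟩

/-! ### Monochromes contain no forbidden graph -/

/-- By `hdet`, vertices of `P` have distinct neighborhoods, so a full homomorphism is injective and
the clique coloring pulls back to all pairs in `P`. -/
theorem exists_coloring_of_monochrome {V : Type*} {G : SimpleGraph V} {I : Type*}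
    {P : SimpleGraph I} (hG : IsExactGallaiMonochrome.{_, w, x} G) (hP : FullHomTo P G)
    (hdet : ∀ i j, i ≠ j → ∃ k, ¬ (P.Adj i k ↔ P.Adj j k)) :
    ∃ (K : Type x) (col : I → I → K) (α : K), (∀ i j, col i j = col j i) ∧
      (∀ i j, i ≠ j → (P.Adj i j ↔ col i j = α)) ∧
      ∀ i j k, i ≠ j → j ≠ k → k ≠ i →
        (col i j = col j k ∨ col j k = col k i ∨ col k i = col i j) ∧
        ¬ (col i j = col j k ∧ col j k = col k i) := by
  classical
  obtain ⟨W, Γ, -, -, H, C, s, hs, α, K, ⟨e⟩⟩ := hG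
  obtain ⟨f, hf⟩ := hP
  let g : I → W := fun i => (e (f i)).1.1
  have gs : ∀ i, g i ∈ s := fun i => (e (f i)).1.2
  have hg : ∀ i j, P.Adj i j ↔ (C.labelGraph α).Adj (g i) (g j) := fun i j =>
    (hf i j).trans e.map_adj_iff.symm
  have ginj : ∀ i j, i ≠ j → g i ≠ g j := by
    intro i j hij h
    obtain ⟨k, hk⟩ := hdet i j hij
    exact hk (by rw [hg, hg, h])
  have hH : ∀ i j, i ≠ j → H.Adj (g i) (g j) := fun i j hij =>
    hs.isClique (gs i) (gs j) (ginj i j hij)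
  -- The value `none` is taken only on the diagonal.
  refine ⟨Option Γ, fun i j => if h : H.Adj (g i) (g j) then some (C.get _ _ h) else none,
    some α, ?_, ?_, ?_⟩
  · intro i j
    by_cases h : H.Adj (g i) (g j)
    · simp [h, h.symm, C.get_comm (g i) (g j)]
    · have h' : ¬ H.Adj (g j) (g i) := fun h' => h h'.symm
      simp [h, h']
  · intro i j hij
    rw [hg, SimpleGraph.EdgeLabeling.labelGraph_adj]
    simp [hH i j hij, SimpleGraph.EdgeLabeling.get_eq]
  · intro i j k hij hjk hki
    have h1 := hs.not_colorful _ (gs i) _ (gs j) _ (gs k) (hH i j hij) (hH j k hjk) (hH k i hki)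
    have h2 := hs.exact_two _ (gs i) _ (gs j) _ (gs k) (hH i j hij) (hH j k hjk) (hH k i hki)
    simp only [hH i j hij, hH j k hjk, hH k i hki, dif_pos, Option.some.injEq]
    refine ⟨?_, ?_⟩
    · unfold IsColorfulTriangle at h1
      tauto
    · rintro ⟨ha, hb⟩
      rw [triangleColors, ha, hb] at h2
      simp at h2

theorem not_fullHomTo_of_monochrome {V : Type*} {G : SimpleGraph V}
    (hG : IsExactGallaiMonochrome.{_, w, x} G) :
    ¬ FullHomTo (SimpleGraph.cycleGraph 3) G ∧ ¬ FullHomTo (pathP 4) G ∧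
      ¬ FullHomTo graphA G := by
  -- Since `j k` has color `α` while `i j` and `i k` do not, the latter must agree, or the triangle
  -- is colorful.
  have step : ∀ {I K : Type _} {P : SimpleGraph I} {col : I → I → K} {α : K},
      (∀ i j, col i j = col j i) →
      (∀ i j, i ≠ j → (P.Adj i j ↔ col i j = α)) →
      (∀ i j k, i ≠ j → j ≠ k → k ≠ i →
        (col i j = col j k ∨ col j k = col k i ∨ col k i = col i j) ∧
        ¬ (col i j = col j k ∧ col j k = col k i)) →
      ∀ i j k, i ≠ j ∧ i ≠ k ∧ P.Adj j k ∧ ¬ P.Adj i j ∧ ¬ P.Adj i k → col i j = col i k := by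
    rintro I K P col α hsymm hα hT i j k ⟨hij, hik, hjk, n1, n2⟩
    have h := (hT i j k hij hjk.ne hik.symm).1
    rw [hα _ _ hij] at n1
    rw [hα _ _ hik] at n2
    rw [hα _ _ hjk.ne] at hjk
    rw [hsymm k i, hjk] at h
    rcases h with h | h | h
    · exact absurd h n1
    · exact absurd h.symm n2
    · exact h.symm
  refine ⟨fun h => ?_, fun h => ?_, fun h => ?_⟩
  · obtain ⟨K, col, α, hsymm, hα, hT⟩ := exists_coloring_of_monochrome hG h (by decide)
    refine (hT 0 1 2 (by decide) (by decide) (by decide)).2 ?_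
    rw [(hα 0 1 (by decide)).1 (by decide), (hα 1 2 (by decide)).1 (by decide),
      (hα 2 0 (by decide)).1 (by decide)]
    exact ⟨rfl, rfl⟩
  · obtain ⟨K, col, α, hsymm, hα, hT⟩ := exists_coloring_of_monochrome hG h (by
      simp only [SimpleGraph.pathGraph_adj]; decide)
    have st := step hsymm hα hT
    simp only [SimpleGraph.pathGraph_adj] at st
    have h1 := st 0 2 3 (by decide)
    have h2 := st 0 3 4 (by decide)
    have h3 := st 4 0 1 (by decide)
    have h4 := st 4 1 2 (by decide)
    -- Propagation makes the triangle on the pairwise nonadjacent vertices 0, 2, 4 monochromatic.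
    refine (hT 0 2 4 (by decide) (by decide) (by decide)).2 ?_
    rw [h1, h2, hsymm 2 4, ← h4, ← h3, hsymm 0 4]
    exact ⟨rfl, rfl⟩
  · have hA : ∀ i j, graphA.Adj i j ↔
        s(i, j) ∈ ({s(0, 1), s(1, 2), s(1, 4), s(2, 3), s(3, 4), s(4, 5)} : Finset _) := by
      intro i j
      rw [graphA, SimpleGraph.fromEdgeSet_adj]
      simp only [Set.mem_insert_iff, Set.mem_singleton_iff, Finset.mem_insert,
        Finset.mem_singleton, and_iff_left_iff_imp]
      rintro h rfl
      revert h i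
      decide
    obtain ⟨K, col, α, hsymm, hα, hT⟩ := exists_coloring_of_monochrome hG h (by
      simp only [hA]; decide)
    have st := step hsymm hα hT
    simp only [hA] at st
    have h1 := st 0 2 3 (by decide)
    have h2 := st 0 3 4 (by decide)
    have h3 := st 0 4 5 (by decide)
    have h4 := st 5 0 1 (by decide)
    have h5 := st 5 1 2 (by decide)
    have h6 := st 2 4 5 (by decide)
    refine (hT 0 2 4 (by decide) (by decide) (by decide)).2 ?_
    rw [h1, h2, h6, hsymm 2 5, ← h5, ← h4, hsymm 4 0, h3, hsymm 0 5]
    exact ⟨rfl, rfl⟩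

/-! ### Coloring a blow-up of the 5-cycle -/

theorem ncard_triple_eq_two {K : Type*} {a b c : K}
    (h : (a = b ∧ b ≠ c) ∨ (b = c ∧ c ≠ a) ∨ (c = a ∧ a ≠ b)) :
    ({a, b, c} : Set K).ncard = 2 := by
  rcases h with ⟨rfl, h⟩ | ⟨rfl, h⟩ | ⟨rfl, h⟩
  · simpa using Set.ncard_pair h
  · simpa using Set.ncard_pair h.symm
  · rw [Set.insert_comm]
    simpa using Set.ncard_pair h.symm

/-- The color of the pair `a, b` in an exact Gallai coloring which extends the blow-up `f` of the
5-cycle: `none` on the edges of the blow-up, and `some (some (min a b))` inside the fibers. -/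
def blowupColor {n : ℕ} (f : Fin n → Fin 5) (a b : Fin n) : Option (Option (Fin n)) :=
  if f a = f b then some (some (min a b))
  else if (SimpleGraph.cycleGraph 5).Adj (f a) (f b) then none else some none

theorem blowupColor_comm {n : ℕ} (f : Fin n → Fin 5) (a b : Fin n) :
    blowupColor f a b = blowupColor f b a := by
  simp only [blowupColor, min_comm, eq_comm, SimpleGraph.adj_comm]

theorem blowupColor_triangle {n : ℕ} (f : Fin n → Fin 5) {a b c : Fin n} (hab : a ≠ b)
    (hbc : b ≠ c) (hca : c ≠ a) :
    (blowupColor f a b = blowupColor f b c ∧ blowupColor f b c ≠ blowupColor f c a) ∨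
    (blowupColor f b c = blowupColor f c a ∧ blowupColor f c a ≠ blowupColor f a b) ∨
    (blowupColor f c a = blowupColor f a b ∧ blowupColor f a b ≠ blowupColor f b c) := by
  -- Neither the 5-cycle nor its complement has a triangle.
  have key : ∀ i j k : Fin 5, i ≠ j → j ≠ k → k ≠ i →
      let d := fun i j => decide ((SimpleGraph.cycleGraph 5).Adj i j)
      (d i j = d j k ∧ d j k ≠ d k i) ∨ (d j k = d k i ∧ d k i ≠ d i j) ∨
      (d k i = d i j ∧ d i j ≠ d j k) := by decide
  unfold blowupColor
  by_cases h1 : f a = f b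
  · by_cases h2 : f b = f c
    -- In one fiber, the least vertex colors two edges and the middle one the third.
    · simp only [h1, h2, if_true, Option.some.injEq, ne_eq, Fin.ext_iff, Fin.coe_min] at *
      omega
    · have h3 : ¬ f c = f b := fun h => h2 h.symm
      right; left
      rw [h1]
      simp only [h2, h3, if_false, if_true, SimpleGraph.adj_comm _ (f c) (f b)]
      refine ⟨trivial, ?_⟩
      split_ifs <;> simp
  · by_cases h2 : f b = f c
    · have h3 : ¬ f c = f a := fun h => h1 (h2.trans h).symm
      right; right
      have h4 : ¬ f a = f c := fun h => h3 h.symm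
      rw [h2]
      simp only [h3, h4, if_false, if_true, SimpleGraph.adj_comm _ (f c) (f a)]
      refine ⟨trivial, ?_⟩
      split_ifs <;> simp
    · by_cases h3 : f c = f a
      · left
        have h4 : ¬ f b = f a := fun h => h1 h.symm
        rw [h3]
        simp only [h1, h4, if_false, if_true, SimpleGraph.adj_comm _ (f b) (f a)]
        refine ⟨trivial, ?_⟩
        split_ifs <;> simp
      · have := key _ _ _ h1 h2 h3
        simp only [h1, h2, h3, if_false]
        by_cases d1 : (SimpleGraph.cycleGraph 5).Adj (f a) (f b) <;>
        by_cases d2 : (SimpleGraph.cycleGraph 5).Adj (f b) (f c) <;>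
        by_cases d3 : (SimpleGraph.cycleGraph 5).Adj (f c) (f a) <;>
        simp [d1, d2, d3] at this ⊢

theorem exists_iso_component {V : Type*} {V' : Type*} {G : SimpleGraph V} {G' : SimpleGraph V'}
    (hG : G.Connected) (e : G ≃g G') :
    ∃ K : G'.ConnectedComponent, Nonempty (G ≃g K.toSimpleGraph) := by
  obtain ⟨v⟩ := hG.nonempty
  refine ⟨G'.connectedComponentMk (e v), ⟨⟨⟨fun u => ⟨e u, ?_⟩, fun u => e.symm u.1, ?_, ?_⟩, ?_⟩⟩⟩
  · exact SimpleGraph.ConnectedComponent.sound ((hG.preconnected u v).map e.toHom)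
  · intro u; simp
  · intro u; simp
  · intro a b
    exact e.map_adj_iff

/-- The color class `none` of `blowupColor` is a copy of `G`, which is a single component because
`G` is connected. -/
theorem isExactGallaiMonochrome_of_fullHomTo {V : Type u} [Finite V] {G : SimpleGraph V}
    (hG : G.Connected) (h : FullHomTo G (SimpleGraph.cycleGraph 5)) :
    IsExactGallaiMonochrome.{u, w, x} G := by
  obtain ⟨f, hf⟩ := h
  obtain ⟨n, ⟨e⟩⟩ := Finite.exists_equiv_fin V
  let C : (⊤ : SimpleGraph (ULift.{w} (Fin n))).EdgeLabeling
      (ULift.{x} (Option (Option (Fin n)))) :=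
    .mk (fun a b _ => ⟨blowupColor (f ∘ e.symm) a.down b.down⟩)
      fun a b _ => by rw [blowupColor_comm]
  have hC : ∀ a b h, C.get a b h = ⟨blowupColor (f ∘ e.symm) a.down b.down⟩ := fun a b h => rfl
  have tri : ∀ a b c (h₁ : (⊤ : SimpleGraph (ULift.{w} (Fin n))).Adj a b)
      (h₂ : (⊤ : SimpleGraph (ULift.{w} (Fin n))).Adj b c)
      (h₃ : (⊤ : SimpleGraph (ULift.{w} (Fin n))).Adj c a),
      (C.get a b h₁ = C.get b c h₂ ∧ C.get b c h₂ ≠ C.get c a h₃) ∨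
      (C.get b c h₂ = C.get c a h₃ ∧ C.get c a h₃ ≠ C.get a b h₁) ∨
      (C.get c a h₃ = C.get a b h₁ ∧ C.get a b h₁ ≠ C.get b c h₂) := by
    intro a b c h₁ h₂ h₃
    simp only [hC, ne_eq, ULift.up_inj]
    exact blowupColor_triangle _ (fun h => h₁.ne (ULift.ext _ _ h))
      (fun h => h₂.ne (ULift.ext _ _ h)) (fun h => h₃.ne (ULift.ext _ _ h))
  refine ⟨ULift.{w} (Fin n), ULift.{x} (Option (Option (Fin n))), inferInstance, inferInstance,
    ⊤, C, Set.univ, ⟨⟨?_, ?_, ?_⟩, ?_⟩, ⟨none⟩, ?_⟩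
  · obtain ⟨v⟩ := hG.nonempty
    exact ⟨⟨e v⟩, trivial⟩
  · intro a _ b _ hab
    exact hab
  · intro a _ b _ c _ h₁ h₂ h₃ h
    have := tri a b c h₁ h₂ h₃
    unfold IsColorfulTriangle at h
    tauto
  · intro a _ b _ c _ h₁ h₂ h₃
    exact ncard_triple_eq_two (tri a b c h₁ h₂ h₃)
  · refine exists_iso_component hG
      ⟨⟨fun v => ⟨⟨e v⟩, trivial⟩, fun a => e.symm a.1.down, ?_, ?_⟩, ?_⟩
    · intro v; simp
    · intro a
      apply Subtype.ext
      simp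
    · intro a b
      have hab : (SimpleGraph.cycleGraph 5).Adj (f a) (f b) → f a ≠ f b := fun h => h.ne
      have hne : (SimpleGraph.cycleGraph 5).Adj (f a) (f b) → a ≠ b := fun h h' => hab h (h' ▸ rfl)
      simp only [Equiv.coe_fn_mk, SimpleGraph.comap_adj, Function.Embedding.subtype_apply,
        SimpleGraph.TopEdgeLabeling.labelGraph_adj, hC, ULift.up_inj, hf a b, blowupColor,
        Function.comp_apply, Equiv.symm_apply_apply]
      split_ifs with h1 h2
      · simpa using fun h => hab h h1
      · simpa [h2] using hne h2
      · simp [h2]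

end FullHom

theorem mainTheorem5 {V : Type u} [Finite V] (G : SimpleGraph V) (hG : G.Connected) :
    ((¬ FullHomTo (SimpleGraph.cycleGraph 3) G ∧ ¬ FullHomTo (pathP 4) G ∧
        ¬ FullHomTo graphA G) ↔
      FullHomTo G (SimpleGraph.cycleGraph 5)) ∧
    (FullHomTo G (SimpleGraph.cycleGraph 5) ↔ IsExactGallaiMonochrome.{u, w, x} G) := by
  have h1 : (¬ FullHomTo (SimpleGraph.cycleGraph 3) G ∧ ¬ FullHomTo (pathP 4) G ∧
      ¬ FullHomTo graphA G) → FullHomTo G (SimpleGraph.cycleGraph 5) := fun h =>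
    FullHom.fullHomTo_cycle_of_free hG (FullHom.triangleFree_of_not_fullHomTo h.1)
      (FullHom.pathFree_of_not_fullHomTo h.2.1) (FullHom.graphAFree_of_not_fullHomTo h.2.2)
  exact ⟨⟨h1, fun h => FullHom.not_fullHomTo_of_monochrome
      (FullHom.isExactGallaiMonochrome_of_fullHomTo.{u, w, x} hG h)⟩,
    FullHom.isExactGallaiMonochrome_of_fullHomTo hG,
    fun h => h1 (FullHom.not_fullHomTo_of_monochrome h)⟩
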